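/- Let $\tfrac12\le\gamma<1$, $b>0$ and $\alpha=1/\gamma$, so that $1<\alpha\le 2$. Put $$g_\gamma(x)=\frac1{2\pi}\int_{-\infty}^{\infty}e^{-i\lambda x}\exp\Big\{-b|\lambda|^{\gamma}e^{-\frac{i\pi\gamma}{2}\frac{\lambda}{|\lambda|}}\Big\}\,d\lambda .$$ Let $(D(x))_{x\ge 0}$ be a stable subordinator for which $D(1)$ has density $g_\gamma$. That is, $D(0)=0$ almost surely, $D$ has independent and stationary increments, and its paths are almost surely nondecreasing and right-continuous. Let $E_t=\inf\{x>0: D(x)>t\}$ be its hitting time process (the inverse stable subordinator). Then for every $t>0$ the random variable $E_t$ has the density $$h(x,t)=\frac t\gamma\,x^{-1-1/\gamma}\,g_\gamma\big(t\,x^{-1/\gamma}\big)\quad (x>0),\qquad h(x,t)=0\quad (x\le 0),$$ which is continuous in $x$ on $(0,\infty)$, and $$\frac{\partial h(x,t)}{\partial t}=b^{-\alpha}\,\frac{\partial^{\alpha}h(x,t)}{\partial(-x)^{\alpha}}\qquad\text{for all } x>0,\ t>0 .$$ Here the right-hand side is the negative Riemann–Liouville derivative of order $\alpha$ in $x$: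 $$\frac{\partial^{\alpha}h(x,t)}{\partial(-x)^{\alpha}}=\frac1{\Gamma(2-\alpha)}\frac{d^2}{dx^2}\int_x^\infty\frac{h(y,t)}{(y-x)^{\alpha-1}}\,dy\quad(1<\alpha<2),\qquad \frac{\partial^{2}h(x,t)}{\partial(-x)^{2}}=\frac{\partial^2h(x,t)}{\partial x^2}\quad(\alpha=2).$$ For all $x>0$ and $t>0$, the derivative in $t$ exists, the integral converges absolutely (for $\alpha<2$), and the function differentiated in $x$ is twice continuously differentiable near $x$. -/

import Mathlib

open MeasureTheory ProbabilityTheory Set Filter Topology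
open scoped NNReal

noncomputable section

/-- The stable density `p_α(x; η, b)`: the inverse Fourier transform
`(1 / 2π) ∫ exp(-iλx) exp(-b |λ|^α exp(-(iπη/2) λ/|λ|)) dλ`.
The integral is real, since its integrand at `-λ` is the conjugate of its integrand at `λ`. -/
def stableDensity (α η b x : ℝ) : ℝ :=
  ((1 / (2 * Real.pi) : ℂ) * ∫ l : ℝ,
    Complex.exp (-Complex.I * l * x) *
      Complex.exp (-(b : ℂ) * ((|l| ^ α : ℝ) : ℂ) *
        Complex.exp (-(Complex.I * Real.pi * η / 2) * ((l / |l| : ℝ) : ℂ)))).re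

/-- The function `f` is a probability density, with respect to Lebesgue measure, of the real
random variable `X`. -/
structure HasDensity {Ω : Type*} [MeasurableSpace Ω] (X : Ω → ℝ) (P : Measure Ω)
    (f : ℝ → ℝ) : Prop where
  nonneg : ∀ x, 0 ≤ f x
  measurable : Measurable f
  hasLaw : HasLaw X (volume.withDensity fun x => ENNReal.ofReal (f x)) P

/-- `D` is a stable subordinator of index `γ`: a nondecreasing, right-continuous process that
starts at `0` and has independent and stationary increments, where `D 1` has the stable density
`p_γ(x; γ, b)`. -/
structure IsStableSubordinator {Ω : Type*} [MeasurableSpace Ω] (γ b : ℝ)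
    (D : ℝ≥0 → Ω → ℝ) (P : Measure Ω) : Prop where
  measurable : ∀ x, Measurable (D x)
  start : ∀ᵐ ω ∂P, D 0 ω = 0
  paths : ∀ᵐ ω ∂P, Monotone (fun x => D x ω) ∧
    ∀ x, ContinuousWithinAt (fun y => D y ω) (Ici x) x
  indep : HasIndepIncrements D P
  stationary : ∀ s x, IdentDistrib (fun ω => D (s + x) ω - D s ω) (D x) P P
  density_one : HasDensity (D 1) P (stableDensity γ γ b)

/-- The inverse (hitting time) process `E_t = inf {x > 0 : D(x) > t}`. -/
def hittingTime {Ω : Type*} (D : ℝ≥0 → Ω → ℝ) (t : ℝ) (ω : Ω) : ℝ :=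
  ((sInf {x : ℝ≥0 | 0 < x ∧ t < D x ω} : ℝ≥0) : ℝ)

/-- The function `h(x, t) = (t / γ) x^(-1-1/γ) g(t x^(-1/γ))` for `x > 0`, where
`g(u) = p_γ(u; γ, b)`, extended by `0` to `x ≤ 0`. -/
def inverseStableDensity (γ b x t : ℝ) : ℝ :=
  if 0 < x then t / γ * x ^ (-1 - 1 / γ) * stableDensity γ γ b (t * x ^ (-(1 / γ))) else 0

/-- The right-sided fractional integral of order `ν ≥ 0`:
`(1 / Γ(ν)) ∫_x^∞ (y - x)^(ν - 1) f(y) dy` if `ν > 0`, and `f x` if `ν = 0`. -/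
def negFracIntegral (ν : ℝ) (f : ℝ → ℝ) (x : ℝ) : ℝ :=
  if ν = 0 then f x else 1 / Real.Gamma ν * ∫ y in Ioi x, (y - x) ^ (ν - 1) * f y

/-- The negative Riemann–Liouville fractional derivative of `f` of order `α > 0` exists at `x`
and equals `q`. With `n - 1 < α ≤ n` it is `(-1)^n` times the `n`-th derivative of the
right-sided fractional integral of order `n - α`. The integral is required to converge near `x`
(when `α < n`) and the fractional integral to be of class `C^n` near `x`. -/
structure HasNegRLDerivAt (α : ℝ) (f : ℝ → ℝ) (q x : ℝ) : Prop where
  integrable : α < ⌈α⌉₊ →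
    ∀ᶠ z in 𝓝 x, IntegrableOn (fun y => (y - z) ^ ((⌈α⌉₊ : ℝ) - α - 1) * f y) (Ioi z)
  contDiffAt : ContDiffAt ℝ (⌈α⌉₊ : ℕ) (negFracIntegral (⌈α⌉₊ - α) f) x
  eq : (-1) ^ ⌈α⌉₊ * iteratedDeriv ⌈α⌉₊ (negFracIntegral (⌈α⌉₊ - α) f) x = q

end

/-!
Write `J p x t = ∫ exp(-iλt) (-iλ)^p exp(-x b (-iλ)^γ) dλ` (`stableIntegral`). The damping
`Re (b (-iλ)^γ) = b cos(πγ/2) |λ|^γ` makes it absolutely convergent for `p > -1` and `x > 0`.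

Analysis. The density is `g(u) = J 0 1 u / 2π`, and the substitution `λ = x^(1/γ) μ` gives
`g(t x^(-1/γ)) = x^(1/γ) J 0 x t / 2π`. Integration by parts (`mul_stableIntegral_zero`) turns the
factor `t` into a derivative of the exponential and yields `h(x, t) = b J (γ-1) x t / 2π`
(`inverseStableDensity_eq`). On such integrals all operators act on the exponent `p`: `∂/∂t` adds `1`,
`∂/∂x` adds `γ` with the factor `-b`, and the right-sided fractional integral of order `ν` subtracts
`γν` with the factor `b^(-ν)` (`frac_stableIntegral`, by Fubini and the Gamma integral at the complex
rate `b (-iλ)^γ`, `integral_rpow_mul_cexp`). With `α = 1/γ` and `ν = 2 - α` both `∂h/∂t` and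
`b^(-α) ∂^α h/∂(-x)^α` become `b J γ x t / 2π`.

Probability. Fourier inversion gives the characteristic function `exp(-b (-iλ)^γ)` of `D 1`
(`charFun_stableDensity`). Independent stationary increments determine that of `D x` at rational `x`
up to roots of unity, and continuity in `λ` excludes all of these but `1`; right-continuity of the
paths covers the remaining times (`charFun_stableSubordinator`). So `D x` is distributed as
`x^(1/γ) D 1`, and a change of variables shows `P (D x > t) = ∫_0^x h(y, t) dy`. Since the paths are
monotone, `{E_t < x} ⊆ {D x > t} ⊆ {E_t ≤ x}` almost surely, which identifies the law of the
hitting time (`hasDensity_hittingTime`).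
-/

/-! ### Powers of `-iλ` -/

/-- The power `(-iλ)^p` of the boundary value `-iλ` of the right half-plane, with the principal
branch of the power. -/
noncomputable def halfPlanePow (p l : ℝ) : ℂ := (-Complex.I * l) ^ (p : ℂ)

lemma norm_halfPlanePow (p l : ℝ) : ‖halfPlanePow p l‖ = |l| ^ p := by
  simp [halfPlanePow, Complex.norm_cpow_real]

@[simp] lemma halfPlanePow_zero_exponent (l : ℝ) : halfPlanePow 0 l = 1 := by
  simp [halfPlanePow]

@[simp] lemma halfPlanePow_one (l : ℝ) : halfPlanePow 1 l = -Complex.I * l := by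
  simp [halfPlanePow]

lemma halfPlanePow_zero {p : ℝ} (hp : p ≠ 0) : halfPlanePow p 0 = 0 := by
  simp [halfPlanePow, hp]

lemma neg_I_mul_ne_zero {l : ℝ} (hl : l ≠ 0) : -Complex.I * (l : ℂ) ≠ 0 := by
  simp [hl]

lemma halfPlanePow_add {l : ℝ} (hl : l ≠ 0) (p q : ℝ) :
    halfPlanePow (p + q) l = halfPlanePow p l * halfPlanePow q l := by
  simp only [halfPlanePow, Complex.ofReal_add]
  exact Complex.cpow_add _ _ (neg_I_mul_ne_zero hl)

lemma halfPlanePow_eq_of_ne {l : ℝ} (hl : l ≠ 0) (p : ℝ) :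
    halfPlanePow p l = ((|l| ^ p : ℝ) : ℂ) *
      Complex.exp (-(Complex.I * Real.pi * p / 2) * ((l / |l| : ℝ) : ℂ)) := by
  have hlog : Complex.log (-Complex.I * l) =
      Real.log |l| + -(Complex.I * Real.pi / 2) * ((l / |l| : ℝ) : ℂ) := by
    rcases lt_or_gt_of_ne hl with h | h
    · rw [show (-Complex.I * l : ℂ) = ((-l : ℝ) : ℂ) * Complex.I by push_cast; ring,
        Complex.log_ofReal_mul (by linarith) Complex.I_ne_zero, Complex.log_I, abs_of_neg h,
        show l / -l = -1 by field_simp]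
      push_cast; ring
    · rw [show (-Complex.I * l : ℂ) = (l : ℂ) * -Complex.I by ring,
        Complex.log_ofReal_mul h (by simp), Complex.log_neg_I, abs_of_pos h,
        div_self hl]
      push_cast; ring
  rw [halfPlanePow, Complex.cpow_def_of_ne_zero (neg_I_mul_ne_zero hl), hlog,
    Real.rpow_def_of_pos (abs_pos.2 hl), Complex.ofReal_exp, ← Complex.exp_add]
  congr 1; push_cast; ring

lemma halfPlanePow_eq {p : ℝ} (hp : p ≠ 0) (l : ℝ) :
    halfPlanePow p l = ((|l| ^ p : ℝ) : ℂ) *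
      Complex.exp (-(Complex.I * Real.pi * p / 2) * ((l / |l| : ℝ) : ℂ)) := by
  rcases eq_or_ne l 0 with rfl | hl
  · simp [halfPlanePow_zero hp, Real.zero_rpow hp]
  · exact halfPlanePow_eq_of_ne hl p

lemma halfPlanePow_re {p : ℝ} (hp : p ≠ 0) (l : ℝ) :
    (halfPlanePow p l).re = |l| ^ p * Real.cos (Real.pi * p / 2) := by
  rcases eq_or_ne l 0 with rfl | hl
  · simp [halfPlanePow_zero hp, Real.zero_rpow hp]
  rw [halfPlanePow_eq hp, Complex.re_ofReal_mul]
  congr 1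
  rcases lt_or_gt_of_ne hl with h | h
  · rw [abs_of_neg h, show l / -l = -1 by field_simp,
      show -(Complex.I * Real.pi * p / 2) * ((-1 : ℝ) : ℂ) =
        ((Real.pi * p / 2 : ℝ) : ℂ) * Complex.I by push_cast; ring, Complex.exp_ofReal_mul_I_re]
  · rw [abs_of_pos h, div_self hl,
      show -(Complex.I * Real.pi * p / 2) * ((1 : ℝ) : ℂ) =
        ((-(Real.pi * p / 2) : ℝ) : ℂ) * Complex.I by push_cast; ring,
      Complex.exp_ofReal_mul_I_re, Real.cos_neg]

lemma measurable_halfPlanePow (p : ℝ) : Measurable (halfPlanePow p) := by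
  unfold halfPlanePow; fun_prop

lemma hasDerivAt_halfPlanePow (p : ℝ) {l : ℝ} (hl : l ≠ 0) :
    HasDerivAt (halfPlanePow p) (-Complex.I * p * halfPlanePow (p - 1) l) l := by
  have h1 : HasDerivAt (fun z : ℂ => -Complex.I * z) (-Complex.I) (l : ℂ) := by
    simpa using (hasDerivAt_id (l : ℂ)).const_mul (-Complex.I)
  have h2 := (h1.cpow_const (c := (p : ℂ)) (by
    right; simpa using hl)).comp_ofReal
  refine h2.congr_deriv ?_
  simp only [halfPlanePow]; push_cast; ring

lemma continuous_halfPlanePow {p : ℝ} (hp : 0 < p) : Continuous (halfPlanePow p) := by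
  rw [continuous_iff_continuousAt]
  intro l
  rcases eq_or_ne l 0 with rfl | hl
  · rw [ContinuousAt, halfPlanePow_zero hp.ne', tendsto_zero_iff_norm_tendsto_zero]
    simp only [norm_halfPlanePow]
    have : Continuous fun l : ℝ => |l| ^ p :=
      continuous_abs.rpow_const (fun _ => Or.inr hp.le)
    simpa [Real.zero_rpow hp.ne'] using this.tendsto 0
  · exact (hasDerivAt_halfPlanePow p hl).continuousAt

/-- The real part of `b (-iλ)^γ` is `stableDecay γ b * |λ|^γ`. -/
noncomputable def stableDecay (γ b : ℝ) : ℝ := b * Real.cos (Real.pi * γ / 2)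

lemma stableDecay_pos {γ b : ℝ} (h0 : 0 < γ) (h1 : γ < 1) (hb : 0 < b) : 0 < stableDecay γ b := by
  refine mul_pos hb (Real.cos_pos_of_mem_Ioo ⟨?_, ?_⟩) <;> nlinarith [Real.pi_pos]

lemma mul_halfPlanePow_re {γ : ℝ} (b : ℝ) (h0 : 0 < γ) (l : ℝ) :
    (b * halfPlanePow γ l : ℂ).re = stableDecay γ b * |l| ^ γ := by
  rw [Complex.re_ofReal_mul, halfPlanePow_re h0.ne', stableDecay]; ring

lemma norm_exp_neg_mul_halfPlanePow {γ : ℝ} (b : ℝ) (h0 : 0 < γ) (x l : ℝ) :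
    ‖Complex.exp (-x * (b * halfPlanePow γ l))‖ =
      Real.exp (-(x * stableDecay γ b) * |l| ^ γ) := by
  rw [Complex.norm_exp, show (-(x : ℂ)) = ((-x : ℝ) : ℂ) by simp, Complex.re_ofReal_mul,
    mul_halfPlanePow_re b h0]
  congr 1; ring

/-! ### Oscillatory integrals of stable type -/

lemma integrable_abs_rpow_mul_exp {p γ k : ℝ} (hp : -1 < p) (hγ : 0 < γ) (hk : 0 < k) :
    Integrable fun l : ℝ => |l| ^ p * Real.exp (-k * |l| ^ γ) := by
  have h := integrableOn_rpow_mul_exp_neg_mul_rpow hp hγ hk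
  have h1 : IntegrableOn (fun l : ℝ => |l| ^ p * Real.exp (-k * |l| ^ γ)) (Ioi 0) :=
    h.congr_fun (fun l hl => by simp only [abs_of_pos (mem_Ioi.1 hl)]) measurableSet_Ioi
  have h2 : IntegrableOn (fun l : ℝ => |l| ^ p * Real.exp (-k * |l| ^ γ)) (Iic 0) := by
    rw [← integrableOn_Ici_iff_integrableOn_Ioi] at h1
    have := h1.comp_neg
    simpa using this
  rw [← integrableOn_univ, ← Iic_union_Ioi (a := (0 : ℝ))]
  exact h2.union h1

/-- The integrand of `stableIntegral`, as a function of the frequency `l`. -/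
noncomputable def stableKernel (γ b p x t l : ℝ) : ℂ :=
  Complex.exp (-Complex.I * l * t) *
    (halfPlanePow p l * Complex.exp (-x * (b * halfPlanePow γ l)))

/-- The oscillatory integral `∫ exp(-iλt) (-iλ)^p exp(-x b (-iλ)^γ) dλ`. All functions of the
theorem are of this form, up to constants: differentiating in `t` adds `1` to `p`,
differentiating in `x` adds `γ`, and a fractional integral of order `ν` in `x` subtracts `γν`. -/
noncomputable def stableIntegral (γ b p x t : ℝ) : ℂ := ∫ l, stableKernel γ b p x t l

lemma norm_exp_neg_I_mul (l t : ℝ) : ‖Complex.exp (-Complex.I * l * t)‖ = 1 := by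
  rw [show -Complex.I * l * t = ((-(l * t) : ℝ) : ℂ) * Complex.I by push_cast; ring,
    Complex.norm_exp_ofReal_mul_I]

lemma norm_stableKernel {γ : ℝ} (h0 : 0 < γ) (b p x t l : ℝ) :
    ‖stableKernel γ b p x t l‖ = |l| ^ p * Real.exp (-(x * stableDecay γ b) * |l| ^ γ) := by
  rw [stableKernel, norm_mul, norm_mul, norm_exp_neg_I_mul, norm_halfPlanePow,
    norm_exp_neg_mul_halfPlanePow b h0, one_mul]

lemma measurable_stableKernel_right (γ b p x t : ℝ) : Measurable (stableKernel γ b p x t) := by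
  have h1 := measurable_halfPlanePow p
  have h2 := measurable_halfPlanePow γ
  unfold stableKernel
  fun_prop

section
variable {γ b p x : ℝ}

lemma integrable_stableKernel (h0 : 0 < γ) (h1 : γ < 1) (hb : 0 < b) (hp : -1 < p) (hx : 0 < x)
    (t : ℝ) : Integrable (stableKernel γ b p x t) := by
  refine (integrable_abs_rpow_mul_exp hp h0 (mul_pos hx (stableDecay_pos h0 h1 hb))).mono'
    (measurable_stableKernel_right γ b p x t).aestronglyMeasurable (ae_of_all _ fun l => ?_)
  rw [norm_stableKernel h0]

lemma mul_stableKernel {l : ℝ} (hl : l ≠ 0) (q t : ℝ) :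
    halfPlanePow q l * stableKernel γ b p x t l = stableKernel γ b (p + q) x t l := by
  rw [stableKernel, stableKernel, halfPlanePow_add hl]; ring

-- The exponent law for `halfPlanePow` fails at `λ = 0`, so pointwise identities between kernels
-- are used almost everywhere.
lemma ae_ne_zero : ∀ᵐ l : ℝ, l ≠ 0 := by
  simp [ae_iff, measure_singleton]

lemma hasDerivAt_stableIntegral_space (h0 : 0 < γ) (h1 : γ < 1) (hb : 0 < b) (hp : -1 < p)
    (hx : 0 < x) (t : ℝ) :
    HasDerivAt (fun y => stableIntegral γ b p y t) (-b * stableIntegral γ b (p + γ) x t) x := by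
  have hk := stableDecay_pos h0 h1 hb
  -- On `y > x / 2` the damping factor is at most its value at `x / 2`.
  have key := hasDerivAt_integral_of_dominated_loc_of_deriv_le (μ := volume) (𝕜 := ℝ)
    (s := Ioi (x / 2)) (x₀ := x) (F := fun y l => stableKernel γ b p y t l)
    (F' := fun y l => -(b * halfPlanePow γ l) * stableKernel γ b p y t l)
    (bound := fun l => b * (|l| ^ (p + γ) * Real.exp (-(x / 2 * stableDecay γ b) * |l| ^ γ)))
    (Ioi_mem_nhds (by linarith))
    (Eventually.of_forall fun y => (measurable_stableKernel_right γ b p y t).aestronglyMeasurable)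
    (integrable_stableKernel h0 h1 hb hp hx t)
    (((measurable_const.mul (measurable_halfPlanePow γ)).neg.mul
      (measurable_stableKernel_right γ b p x t)).aestronglyMeasurable)
    (by
      filter_upwards [ae_ne_zero] with l hl y hy
      rw [norm_mul, norm_neg, norm_mul, norm_halfPlanePow, norm_stableKernel h0,
        Real.rpow_add (abs_pos.2 hl), Complex.norm_real, Real.norm_of_nonneg hb.le]
      have : Real.exp (-(y * stableDecay γ b) * |l| ^ γ) ≤
          Real.exp (-(x / 2 * stableDecay γ b) * |l| ^ γ) := by
        have : (x / 2) * stableDecay γ b ≤ y * stableDecay γ b :=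
          mul_le_mul_of_nonneg_right (le_of_lt hy) hk.le
        gcongr
      calc b * |l| ^ γ * (|l| ^ p * Real.exp (-(y * stableDecay γ b) * |l| ^ γ))
          ≤ b * |l| ^ γ * (|l| ^ p * Real.exp (-(x / 2 * stableDecay γ b) * |l| ^ γ)) := by
            gcongr
        _ = _ := by ring)
    ((integrable_abs_rpow_mul_exp (by linarith) h0 (by positivity)).const_mul b)
    (ae_of_all _ fun l y _ => by
      have h : HasDerivAt (fun y : ℝ => -(y : ℂ) * (b * halfPlanePow γ l))
          (-(b * halfPlanePow γ l)) y := by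
        simpa using ((hasDerivAt_id y).ofReal_comp.neg).mul_const (b * halfPlanePow γ l)
      refine ((h.cexp.const_mul (halfPlanePow p l)).const_mul
        (Complex.exp (-Complex.I * l * t))).congr_deriv ?_
      rw [stableKernel]; ring)
  refine key.2.congr_deriv ?_
  rw [stableIntegral, ← integral_const_mul]
  refine integral_congr_ae ?_
  filter_upwards [ae_ne_zero] with l hl
  rw [← mul_stableKernel hl]; ring

lemma hasDerivAt_stableIntegral_time (h0 : 0 < γ) (h1 : γ < 1) (hb : 0 < b) (hp : -1 < p)
    (hx : 0 < x) (t : ℝ) :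
    HasDerivAt (fun s => stableIntegral γ b p x s) (stableIntegral γ b (p + 1) x t) t := by
  have hk := stableDecay_pos h0 h1 hb
  have key := hasDerivAt_integral_of_dominated_loc_of_deriv_le (μ := volume) (𝕜 := ℝ)
    (s := univ) (x₀ := t) (F := fun s l => stableKernel γ b p x s l)
    (F' := fun s l => halfPlanePow 1 l * stableKernel γ b p x s l)
    (bound := fun l => |l| ^ (p + 1) * Real.exp (-(x * stableDecay γ b) * |l| ^ γ))
    univ_mem
    (Eventually.of_forall fun y => (measurable_stableKernel_right γ b p x y).aestronglyMeasurable)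
    (integrable_stableKernel h0 h1 hb hp hx t)
    (((measurable_halfPlanePow 1).mul
      (measurable_stableKernel_right γ b p x t)).aestronglyMeasurable)
    (by
      filter_upwards [ae_ne_zero] with l hl y hy
      rw [mul_stableKernel hl, norm_stableKernel h0])
    (integrable_abs_rpow_mul_exp (by linarith) h0 (by positivity))
    (ae_of_all _ fun l s _ => by
      have h : HasDerivAt (fun s : ℝ => -Complex.I * l * (s : ℂ)) (-Complex.I * l) s := by
        simpa using (hasDerivAt_id s).ofReal_comp.const_mul (-Complex.I * l)
      refine (h.cexp.mul_const
        (halfPlanePow p l * Complex.exp (-x * (b * halfPlanePow γ l)))).congr_deriv ?_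
      rw [stableKernel, halfPlanePow_one]; ring)
  refine key.2.congr_deriv ?_
  rw [stableIntegral]
  refine integral_congr_ae ?_
  filter_upwards [ae_ne_zero] with l hl
  rw [mul_stableKernel hl]

end

/-! ### The hitting time density as an oscillatory integral -/

section
variable {γ b p x : ℝ}

/-- Integration by parts: the derivative of `exp(-iλt) exp(-x b (-iλ)^γ)` in `λ` integrates
to `0`. -/
lemma mul_stableIntegral_zero (h0 : 0 < γ) (h1 : γ < 1) (hb : 0 < b) (hx : 0 < x) (t : ℝ) :
    t * stableIntegral γ b 0 x t = x * b * γ * stableIntegral γ b (γ - 1) x t := by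
  have hk := stableDecay_pos h0 h1 hb
  set u : ℝ → ℂ := stableKernel γ b 0 x t with hu
  set u' : ℝ → ℂ := fun l => -Complex.I * t * stableKernel γ b 0 x t l +
    Complex.I * (x * b * γ) * stableKernel γ b (γ - 1) x t l with hu'
  have hcont : Continuous u := by
    have := continuous_halfPlanePow h0
    rw [hu]
    unfold stableKernel
    simp only [halfPlanePow_zero_exponent]
    fun_prop
  have hder : ∀ l : ℝ, l ≠ 0 → HasDerivAt u (u' l) l := by
    intro l hl
    have e1 : HasDerivAt (fun l : ℝ => -Complex.I * (l : ℂ) * t) (-Complex.I * t) l := by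
      simpa using ((hasDerivAt_id l).ofReal_comp.const_mul (-Complex.I)).mul_const (t : ℂ)
    have e2 := ((hasDerivAt_halfPlanePow γ hl).const_mul (b : ℂ)).const_mul (-(x : ℂ))
    have e3 := e1.cexp.mul (e2.cexp.const_mul (1 : ℂ))
    have e4 : u = fun l : ℝ => Complex.exp (-Complex.I * l * t) *
        (1 * Complex.exp (-x * (b * halfPlanePow γ l))) := by
      ext l; simp [hu, stableKernel]
    rw [e4]
    refine e3.congr_deriv ?_
    simp only [hu', stableKernel, halfPlanePow_zero_exponent]
    ring
  have hint : Integrable u' :=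
    ((integrable_stableKernel h0 h1 hb (by norm_num) hx t).const_mul _).add
      ((integrable_stableKernel h0 h1 hb (by linarith) hx t).const_mul _)
  have hlim : ∀ F : Filter ℝ, Tendsto (fun l : ℝ => |l|) F atTop → Tendsto u F (𝓝 0) := by
    intro F hF
    rw [tendsto_zero_iff_norm_tendsto_zero]
    simp only [hu, norm_stableKernel h0, Real.rpow_zero, one_mul]
    refine Real.tendsto_exp_atBot.comp ?_
    refine Tendsto.const_mul_atTop_of_neg (by nlinarith) ?_
    exact (tendsto_rpow_atTop h0).comp hF
  have i1 := integral_Ioi_of_hasDerivAt_of_tendsto (f := u) (f' := u') (a := 0) (m := 0)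
    hcont.continuousWithinAt (fun l hl => hder l (ne_of_gt hl)) hint.integrableOn
    (hlim _ tendsto_abs_atTop_atTop)
  have i2 := integral_Iic_of_hasDerivAt_of_tendsto (f := u) (f' := u') (a := 0) (m := 0)
    hcont.continuousWithinAt (fun l hl => hder l (ne_of_lt hl)) hint.integrableOn
    (hlim _ tendsto_abs_atBot_atTop)
  have i3 : ∫ l, u' l = 0 := by
    rw [← intervalIntegral.integral_Iic_add_Ioi (b := (0 : ℝ)) hint.integrableOn hint.integrableOn,
      i1, i2]
    ring
  rw [hu', integral_add ((integrable_stableKernel h0 h1 hb (by norm_num) hx t).const_mul _)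
    ((integrable_stableKernel h0 h1 hb (by linarith) hx t).const_mul _),
    integral_const_mul, integral_const_mul] at i3
  have i4 : Complex.I * (t * stableIntegral γ b 0 x t -
      x * b * γ * stableIntegral γ b (γ - 1) x t) = 0 := by
    rw [stableIntegral, stableIntegral]; linear_combination -i3
  have := (mul_eq_zero.1 i4).resolve_left Complex.I_ne_zero
  linear_combination this

lemma halfPlanePow_scale (h0 : 0 < γ) (hx : 0 < x) (l : ℝ) :
    halfPlanePow γ (x ^ (1 / γ) * l) = x * halfPlanePow γ l := by
  have hc : 0 < x ^ (1 / γ) := by positivity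
  rw [halfPlanePow_eq h0.ne', halfPlanePow_eq h0.ne', abs_mul, abs_of_pos hc,
    mul_div_mul_left _ _ hc.ne', Real.mul_rpow hc.le (abs_nonneg _), ← Real.rpow_mul hx.le,
    one_div_mul_cancel h0.ne', Real.rpow_one]
  push_cast; ring

/-- Self-similarity, by the substitution `λ = x^(1/γ) μ`. -/
lemma stableIntegral_zero_scale (h0 : 0 < γ) (hx : 0 < x) (t : ℝ) :
    stableIntegral γ b 0 1 (t * x ^ (-(1 / γ))) =
      (x ^ (1 / γ) : ℝ) * stableIntegral γ b 0 x t := by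
  have hc : 0 < x ^ (1 / γ) := by positivity
  have key := Measure.integral_comp_mul_left
    (fun l => stableKernel γ b 0 1 (t * x ^ (-(1 / γ))) l) (x ^ (1 / γ))
  rw [abs_of_pos (inv_pos.2 hc)] at key
  have hfun : ∀ l : ℝ, stableKernel γ b 0 1 (t * x ^ (-(1 / γ))) (x ^ (1 / γ) * l) =
      stableKernel γ b 0 x t l := by
    intro l
    have e1 := halfPlanePow_scale h0 hx l
    have e2 : x ^ (1 / γ) * l * (t * x ^ (-(1 / γ))) = l * t := by
      rw [Real.rpow_neg hx.le]; field_simp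
    rw [stableKernel, stableKernel, e1, halfPlanePow_zero_exponent, halfPlanePow_zero_exponent,
      mul_assoc (-Complex.I), mul_assoc (-Complex.I), ← Complex.ofReal_mul, ← Complex.ofReal_mul,
      e2]
    congr 3; push_cast; ring
  simp only [hfun] at key
  rw [stableIntegral, stableIntegral, key, Complex.real_smul, ← mul_assoc, ← Complex.ofReal_mul,
    mul_inv_cancel₀ hc.ne']
  simp

lemma stableDensity_eq (h0 : 0 < γ) (b u : ℝ) :
    stableDensity γ γ b u = 1 / (2 * Real.pi) * (stableIntegral γ b 0 1 u).re := by
  rw [stableDensity, stableIntegral, show (1 / (2 * Real.pi) : ℂ) =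
    ((1 / (2 * Real.pi) : ℝ) : ℂ) by push_cast; rfl, Complex.re_ofReal_mul]
  congr 3 with l
  rw [stableKernel, halfPlanePow_zero_exponent, halfPlanePow_eq h0.ne']
  congr 1; rw [one_mul]; congr 1; push_cast; ring

/-- The density of the hitting time as the inverse Fourier transform, in `t`, of
`b (-iλ)^(γ-1) exp(-x b (-iλ)^γ)`. -/
lemma inverseStableDensity_eq (h0 : 0 < γ) (h1 : γ < 1) (hb : 0 < b) (hx : 0 < x) (t : ℝ) :
    inverseStableDensity γ b x t =
      b / (2 * Real.pi) * (stableIntegral γ b (γ - 1) x t).re := by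
  have e1 := congrArg Complex.re (mul_stableIntegral_zero h0 h1 hb hx t)
  rw [Complex.re_ofReal_mul, ← Complex.ofReal_mul, ← Complex.ofReal_mul,
    Complex.re_ofReal_mul] at e1
  have e2 : x ^ (-1 - 1 / γ) = x⁻¹ * (x ^ (1 / γ))⁻¹ := by
    rw [sub_eq_add_neg, Real.rpow_add hx, Real.rpow_neg_one, Real.rpow_neg hx.le]
  have hc : x ^ (1 / γ) ≠ 0 := by positivity
  rw [inverseStableDensity, if_pos hx, stableDensity_eq h0, stableIntegral_zero_scale h0 hx,
    Complex.re_ofReal_mul, e2]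
  have : t / γ * (x⁻¹ * (x ^ (1 / γ))⁻¹) * (1 / (2 * Real.pi) *
      (x ^ (1 / γ) * (stableIntegral γ b 0 x t).re)) =
      1 / (2 * Real.pi) / (γ * x) * (t * (stableIntegral γ b 0 x t).re) := by
    field_simp
  rw [this, e1]
  field_simp

end

/-! ### The Gamma integral at complex rates -/

lemma integrableOn_rpow_mul_exp {ν c : ℝ} (hν : 0 < ν) (hc : 0 < c) :
    IntegrableOn (fun u : ℝ => u ^ (ν - 1) * Real.exp (-c * u)) (Ioi 0) := by
  simpa using integrableOn_rpow_mul_exp_neg_mul_rpow (p := 1) (s := ν - 1) (by linarith) one_pos hc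

lemma integrableOn_rpow_mul_cexp {ν : ℝ} (hν : 0 < ν) {c : ℂ} (hc : 0 < c.re) :
    IntegrableOn (fun u : ℝ => ((u ^ (ν - 1) : ℝ) : ℂ) * Complex.exp (-c * u)) (Ioi 0) := by
  refine (integrableOn_rpow_mul_exp hν hc).mono' (by fun_prop) ?_
  refine (ae_restrict_iff' measurableSet_Ioi).2 (ae_of_all _ fun u hu => ?_)
  rw [norm_mul, Complex.norm_real, Real.norm_of_nonneg (Real.rpow_nonneg (le_of_lt hu) _),
    Complex.norm_exp]
  simp

/-- The Gamma integral at a complex rate `c`. Both sides are holomorphic in `c` on the right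
half-plane and agree for real `c`. -/
lemma integral_rpow_mul_cexp {ν : ℝ} (hν : 0 < ν) {c : ℂ} (hc : 0 < c.re) :
    ∫ u : ℝ in Ioi 0, ((u ^ (ν - 1) : ℝ) : ℂ) * Complex.exp (-c * u) =
      Real.Gamma ν * c ^ (-ν : ℂ) := by
  set U : Set ℂ := {z | 0 < z.re} with hU
  have hUo : IsOpen U := isOpen_lt continuous_const Complex.continuous_re
  have hUc : IsPreconnected U := (convex_halfSpace_re_gt 0).isPreconnected
  set G : ℂ → ℂ := fun z => ∫ u : ℝ in Ioi 0, ((u ^ (ν - 1) : ℝ) : ℂ) * Complex.exp (-z * u)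
    with hG
  have hGd : DifferentiableOn ℂ G U := by
    intro z hz
    have hz' : 0 < z.re := hz
    have key := hasDerivAt_integral_of_dominated_loc_of_deriv_le
      (μ := volume.restrict (Ioi (0 : ℝ))) (𝕜 := ℂ)
      (s := {w : ℂ | z.re / 2 < w.re}) (x₀ := z)
      (F := fun w u => ((u ^ (ν - 1) : ℝ) : ℂ) * Complex.exp (-w * u))
      (F' := fun w u => ((u ^ (ν - 1) : ℝ) : ℂ) * (-u * Complex.exp (-w * u)))
      (bound := fun u => u ^ (ν + 1 - 1) * Real.exp (-(z.re / 2) * u))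
      ((isOpen_lt continuous_const Complex.continuous_re).mem_nhds (by
        change z.re / 2 < z.re; linarith))
      (Eventually.of_forall fun w => by fun_prop)
      (integrableOn_rpow_mul_cexp hν hz') (by fun_prop)
      (by
        refine (ae_restrict_iff' measurableSet_Ioi).2 (ae_of_all _ fun u hu w hw => ?_)
        have hu' : (0 : ℝ) < u := hu
        have hw' : z.re / 2 < w.re := hw
        rw [norm_mul, norm_mul, norm_neg, Complex.norm_real, Complex.norm_real,
          Real.norm_of_nonneg (Real.rpow_nonneg hu'.le _), Real.norm_of_nonneg hu'.le,
          Complex.norm_exp, show (-w * (u : ℂ)).re = -w.re * u by simp,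
          show ν + 1 - 1 = ν - 1 + 1 by ring, Real.rpow_add hu', Real.rpow_one, mul_assoc]
        gcongr)
      (integrableOn_rpow_mul_exp (by linarith) (by linarith))
      (ae_of_all _ fun u w _ => by
        have h : HasDerivAt (fun w : ℂ => -w * (u : ℂ)) (-u) w := by
          simpa using (hasDerivAt_id w).neg.mul_const (u : ℂ)
        refine (h.cexp.const_mul _).congr_deriv ?_
        ring)
    exact key.2.differentiableAt.differentiableWithinAt
  have hRd : DifferentiableOn ℂ (fun z : ℂ => (Real.Gamma ν : ℂ) * z ^ (-ν : ℂ)) U := by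
    intro z hz
    have : HasDerivAt (fun z : ℂ => z ^ (-ν : ℂ)) _ z :=
      (hasDerivAt_id z).cpow_const (c := (-ν : ℂ)) (Or.inl hz)
    exact (this.const_mul _).differentiableAt.differentiableWithinAt
  have hreal : ∀ r : ℝ, 0 < r → G r = (Real.Gamma ν : ℂ) * (r : ℂ) ^ (-ν : ℂ) := by
    intro r hr
    have h := Real.integral_rpow_mul_exp_neg_mul_Ioi hν hr
    have e : G r = ((∫ u : ℝ in Ioi 0, u ^ (ν - 1) * Real.exp (-(r * u)) : ℝ) : ℂ) := by
      rw [← integral_complex_ofReal]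
      refine integral_congr_ae (ae_of_all _ fun u => ?_)
      simp only [neg_mul]
      push_cast
      rfl
    rw [e, h, one_div, Real.inv_rpow hr.le, ← Real.rpow_neg hr.le, Complex.ofReal_mul,
      Complex.ofReal_cpow hr.le]
    push_cast; ring
  have hfreq : ∃ᶠ z in 𝓝[≠] (1 : ℂ), G z = (Real.Gamma ν : ℂ) * z ^ (-ν : ℂ) := by
    have ht : Tendsto (fun r : ℝ => (r : ℂ)) (𝓝[≠] 1) (𝓝[≠] (1 : ℂ)) := by
      refine tendsto_nhdsWithin_iff.2 ⟨?_, ?_⟩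
      · simpa using (Complex.continuous_ofReal.tendsto 1).mono_left nhdsWithin_le_nhds
      · filter_upwards [self_mem_nhdsWithin] with r hr
        simpa using hr
    refine ht.frequently (Eventually.frequently ?_)
    filter_upwards [nhdsWithin_le_nhds (Ioi_mem_nhds (zero_lt_one' ℝ))] with r hr
    exact hreal r hr
  exact (hGd.analyticOnNhd hUo).eqOn_of_preconnected_of_frequently_eq (hRd.analyticOnNhd hUo) hUc
    (show (1 : ℂ) ∈ U by simp [hU]) hfreq hc

section
variable {γ b : ℝ}

/-- The principal branches are compatible here because `0 < γ < 1`. -/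
lemma mul_halfPlanePow_cpow (h0 : 0 < γ) (h1 : γ < 1) (hb : 0 < b) {l : ℝ} (hl : l ≠ 0) (s : ℝ) :
    (b * halfPlanePow γ l : ℂ) ^ (s : ℂ) = (b ^ s : ℝ) * halfPlanePow (γ * s) l := by
  -- `log b + γ log (-iλ)` has imaginary part in `(-π, π]`, so it is the principal logarithm.
  set L := Complex.log (-Complex.I * l) with hL
  have him : L.im ∈ Ioc (-Real.pi) Real.pi := by
    rw [hL, Complex.log_im]; exact Complex.arg_mem_Ioc _
  have hp : ∀ q : ℝ, halfPlanePow q l = Complex.exp (L * q) := fun q => by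
    rw [halfPlanePow, Complex.cpow_def_of_ne_zero (neg_I_mul_ne_zero hl)]
  have e1 : (b * halfPlanePow γ l : ℂ) = Complex.exp (Real.log b + L * γ) := by
    rw [hp, Complex.exp_add, ← Complex.ofReal_exp, Real.exp_log hb]
  have e2 : (Real.log b + L * γ : ℂ).im = L.im * γ := by simp
  rw [e1, Complex.cpow_def_of_ne_zero (Complex.exp_ne_zero _), Complex.log_exp, hp,
    Real.rpow_def_of_pos hb, Complex.ofReal_exp, ← Complex.exp_add]
  · congr 1; push_cast; ring
  · rw [e2]; nlinarith [him.1, him.2, Real.pi_pos]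
  · rw [e2]; nlinarith [him.1, him.2, Real.pi_pos]

end

/-! ### Fractional integrals in the space variable -/

section
variable {γ b p x ν : ℝ}

lemma stableKernel_add (γ b p x u t l : ℝ) : stableKernel γ b p (x + u) t l =
    stableKernel γ b p x t l * Complex.exp (-(b * halfPlanePow γ l) * u) := by
  rw [stableKernel, stableKernel, show -((x + u : ℝ) : ℂ) * (b * halfPlanePow γ l) =
    -x * (b * halfPlanePow γ l) + -(b * halfPlanePow γ l) * u by push_cast; ring, Complex.exp_add]
  ring

lemma integrableOn_fracKernel (h0 : 0 < γ) (h1 : γ < 1) (hb : 0 < b) (hν : 0 < ν) {l : ℝ}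
    (hl : l ≠ 0) (p x t : ℝ) :
    IntegrableOn (fun u : ℝ => ((u ^ (ν - 1) : ℝ) : ℂ) * stableKernel γ b p (x + u) t l)
      (Ioi 0) := by
  have hre : 0 < (b * halfPlanePow γ l : ℂ).re := by
    rw [mul_halfPlanePow_re b h0]
    exact mul_pos (stableDecay_pos h0 h1 hb) (Real.rpow_pos_of_pos (abs_pos.2 hl) _)
  have := (integrableOn_rpow_mul_cexp hν hre).const_mul (stableKernel γ b p x t l)
  refine this.congr (ae_of_all _ fun u => ?_)
  simp only [stableKernel_add]; ring

lemma integral_fracKernel (h0 : 0 < γ) (h1 : γ < 1) (hb : 0 < b) (hν : 0 < ν) {l : ℝ}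
    (hl : l ≠ 0) (p x t : ℝ) :
    ∫ u : ℝ in Ioi 0, ((u ^ (ν - 1) : ℝ) : ℂ) * stableKernel γ b p (x + u) t l =
      Real.Gamma ν * (b ^ (-ν) : ℝ) * stableKernel γ b (p - γ * ν) x t l := by
  have hre : 0 < (b * halfPlanePow γ l : ℂ).re := by
    rw [mul_halfPlanePow_re b h0]
    exact mul_pos (stableDecay_pos h0 h1 hb) (Real.rpow_pos_of_pos (abs_pos.2 hl) _)
  have e : ∀ u : ℝ, ((u ^ (ν - 1) : ℝ) : ℂ) * stableKernel γ b p (x + u) t l =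
      stableKernel γ b p x t l * (((u ^ (ν - 1) : ℝ) : ℂ) *
        Complex.exp (-(b * halfPlanePow γ l) * u)) := fun u => by
    rw [stableKernel_add]; ring
  simp only [e]
  have e2 := mul_halfPlanePow_cpow h0 h1 hb hl (-ν)
  rw [Complex.ofReal_neg] at e2
  rw [integral_const_mul, integral_rpow_mul_cexp hν hre, e2, sub_eq_add_neg, ← mul_neg,
    ← mul_stableKernel hl]
  ring

/-- The bound that justifies Fubini's theorem: integrating the absolute value over `u` costs
a factor `|λ|^(-γν)` only, which is integrable near `0` together with `|λ|^p` if
`p - γν > -1`. -/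
lemma integral_norm_fracKernel (h0 : 0 < γ) (h1 : γ < 1) (hb : 0 < b) (hν : 0 < ν) {l : ℝ}
    (hl : l ≠ 0) (p x t : ℝ) :
    ∫ u : ℝ in Ioi 0, ‖((u ^ (ν - 1) : ℝ) : ℂ) * stableKernel γ b p (x + u) t l‖ =
      Real.Gamma ν * stableDecay γ b ^ (-ν) *
        (|l| ^ (p - γ * ν) * Real.exp (-(x * stableDecay γ b) * |l| ^ γ)) := by
  have hk := stableDecay_pos h0 h1 hb
  have hl' : 0 < |l| := abs_pos.2 hl
  have hr : 0 < stableDecay γ b * |l| ^ γ := by positivity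
  have e : ∫ u : ℝ in Ioi 0, ‖((u ^ (ν - 1) : ℝ) : ℂ) * stableKernel γ b p (x + u) t l‖ =
      ∫ u : ℝ in Ioi 0, (|l| ^ p * Real.exp (-(x * stableDecay γ b) * |l| ^ γ)) *
        (u ^ (ν - 1) * Real.exp (-(stableDecay γ b * |l| ^ γ * u))) := by
    refine setIntegral_congr_fun measurableSet_Ioi fun u hu => ?_
    rw [norm_mul, Complex.norm_real, Real.norm_of_nonneg (Real.rpow_nonneg (le_of_lt hu) _),
      norm_stableKernel h0, show -((x + u) * stableDecay γ b) * |l| ^ γ =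
        -(x * stableDecay γ b) * |l| ^ γ + -(stableDecay γ b * |l| ^ γ * u) by ring, Real.exp_add]
    ring
  rw [e, integral_const_mul, Real.integral_rpow_mul_exp_neg_mul_Ioi hν hr, one_div,
    Real.inv_rpow hr.le, ← Real.rpow_neg hr.le, Real.mul_rpow hk.le (by positivity),
    ← Real.rpow_mul hl'.le, show p - γ * ν = p + γ * -ν by ring, Real.rpow_add hl']
  ring

lemma integrable_fracKernel_prod (h0 : 0 < γ) (h1 : γ < 1) (hb : 0 < b) (hν : 0 < ν)
    (hp : -1 < p - γ * ν) (hx : 0 < x) (t : ℝ) :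
    Integrable (fun q : ℝ × ℝ =>
      ((q.1 ^ (ν - 1) : ℝ) : ℂ) * stableKernel γ b p (x + q.1) t q.2)
      ((volume.restrict (Ioi 0)).prod volume) := by
  have hk := stableDecay_pos h0 h1 hb
  have hm : Measurable (fun q : ℝ × ℝ =>
      ((q.1 ^ (ν - 1) : ℝ) : ℂ) * stableKernel γ b p (x + q.1) t q.2) := by
    have h1 := measurable_halfPlanePow p
    have h2 := measurable_halfPlanePow γ
    unfold stableKernel
    fun_prop
  refine (integrable_prod_iff' hm.aestronglyMeasurable).2 ⟨?_, ?_⟩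
  · filter_upwards [ae_ne_zero] with l hl
    exact integrableOn_fracKernel h0 h1 hb hν hl p x t
  · refine ((integrable_abs_rpow_mul_exp hp h0 (mul_pos hx hk)).const_mul
      (Real.Gamma ν * stableDecay γ b ^ (-ν))).congr ?_
    filter_upwards [ae_ne_zero] with l hl
    exact (integral_norm_fracKernel h0 h1 hb hν hl p x t).symm

lemma integrableOn_frac_stableIntegral (h0 : 0 < γ) (h1 : γ < 1) (hb : 0 < b) (hν : 0 < ν)
    (hp : -1 < p - γ * ν) (hx : 0 < x) (t : ℝ) :
    IntegrableOn (fun y : ℝ => ((y - x) ^ (ν - 1) : ℝ) * (stableIntegral γ b p y t).re)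
      (Ioi x) := by
  have h := (integrable_fracKernel_prod h0 h1 hb hν hp hx t).integral_prod_left.re
  have h2 : IntegrableOn (fun u : ℝ => (u ^ (ν - 1) : ℝ) * (stableIntegral γ b p (x + u) t).re)
      (Ioi 0) := by
    refine h.congr (ae_of_all _ fun u => ?_)
    simp only [integral_const_mul]
    exact Complex.re_ofReal_mul _ _
  have h3 := (measurePreserving_sub_right volume x).integrableOn_comp_preimage
    (measurableEmbedding_subRight x) (s := Ioi 0)
    (f := fun u : ℝ => (u ^ (ν - 1) : ℝ) * (stableIntegral γ b p (x + u) t).re)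
  have h4 := h3.2 h2
  simpa [Function.comp_def] using h4

/-- A right-sided fractional integral of order `ν` in the space variable lowers the exponent `p`
by `γ ν`. -/
lemma frac_stableIntegral (h0 : 0 < γ) (h1 : γ < 1) (hb : 0 < b) (hν : 0 < ν)
    (hp : -1 < p - γ * ν) (hx : 0 < x) (t : ℝ) :
    ∫ y : ℝ in Ioi x, ((y - x) ^ (ν - 1) : ℝ) * (stableIntegral γ b p y t).re =
      Real.Gamma ν * b ^ (-ν) * (stableIntegral γ b (p - γ * ν) x t).re := by
  have hF := integrable_fracKernel_prod h0 h1 hb hν hp hx t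
  have e1 : ∫ y : ℝ in Ioi x, ((y - x) ^ (ν - 1) : ℝ) * (stableIntegral γ b p y t).re =
      ∫ u : ℝ in Ioi 0, (u ^ (ν - 1) : ℝ) * (stableIntegral γ b p (x + u) t).re := by
    have := (measurePreserving_sub_right volume x).setIntegral_preimage_emb
      (measurableEmbedding_subRight x)
      (fun u : ℝ => (u ^ (ν - 1) : ℝ) * (stableIntegral γ b p (x + u) t).re) (Ioi 0)
    simpa using this
  have e2 : ∫ u : ℝ in Ioi 0, (u ^ (ν - 1) : ℝ) * (stableIntegral γ b p (x + u) t).re =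
      (∫ u : ℝ in Ioi 0, ∫ l : ℝ,
        ((u ^ (ν - 1) : ℝ) : ℂ) * stableKernel γ b p (x + u) t l).re := by
    refine Eq.trans ?_ (integral_re hF.integral_prod_left)
    refine integral_congr_ae (ae_of_all _ fun u => ?_)
    simp only [integral_const_mul]
    exact (Complex.re_ofReal_mul _ _).symm
  rw [e1, e2, integral_integral_swap hF]
  have e3 : ∫ l : ℝ, ∫ u : ℝ in Ioi 0,
      ((u ^ (ν - 1) : ℝ) : ℂ) * stableKernel γ b p (x + u) t l =
      ((Real.Gamma ν * b ^ (-ν) : ℝ) : ℂ) * stableIntegral γ b (p - γ * ν) x t := by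
    rw [stableIntegral, ← integral_const_mul]
    refine integral_congr_ae ?_
    filter_upwards [ae_ne_zero] with l hl
    rw [integral_fracKernel h0 h1 hb hν hl]
    push_cast; ring
  rw [e3, Complex.re_ofReal_mul]

/-- The case `ν = 0`, which occurs for `γ = 1/2`, follows the same formula. -/
lemma negFracIntegral_inverseStableDensity (h0 : 0 < γ) (h1 : γ < 1) (hb : 0 < b) (hν : 0 ≤ ν)
    (hν1 : ν < 1) (hx : 0 < x) (t : ℝ) :
    negFracIntegral ν (fun y => inverseStableDensity γ b y t) x =
      b / (2 * Real.pi) * b ^ (-ν) * (stableIntegral γ b (γ - 1 - γ * ν) x t).re := by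
  rcases hν.eq_or_lt with rfl | hν
  · simp [negFracIntegral, inverseStableDensity_eq h0 h1 hb hx]
  have hΓ := (Real.Gamma_pos_of_pos hν).ne'
  rw [negFracIntegral, if_neg hν.ne']
  have : ∫ y in Ioi x, (y - x) ^ (ν - 1) * inverseStableDensity γ b y t =
      ∫ y in Ioi x, b / (2 * Real.pi) *
        ((y - x) ^ (ν - 1) * (stableIntegral γ b (γ - 1) y t).re) := by
    refine setIntegral_congr_fun measurableSet_Ioi fun y hy => ?_
    simp only [inverseStableDensity_eq h0 h1 hb (hx.trans hy)]
    ring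
  rw [this, integral_const_mul, frac_stableIntegral h0 h1 hb hν (by nlinarith) hx]
  field_simp

lemma integrableOn_frac_inverseStableDensity (h0 : 0 < γ) (h1 : γ < 1) (hb : 0 < b) (hν : 0 < ν)
    (hν1 : ν < 1) (hx : 0 < x) (t : ℝ) :
    IntegrableOn (fun y => (y - x) ^ (ν - 1) * inverseStableDensity γ b y t) (Ioi x) := by
  have h : IntegrableOn (fun y => b / (2 * Real.pi) *
      ((y - x) ^ (ν - 1) * (stableIntegral γ b (γ - 1) y t).re)) (Ioi x) :=
    (integrableOn_frac_stableIntegral h0 h1 hb hν (by nlinarith) hx t).const_mul _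
  refine h.congr_fun (fun y hy => ?_) measurableSet_Ioi
  simp only [inverseStableDensity_eq h0 h1 hb (hx.trans hy)]
  ring

/-! ### The fractional differential equation -/

lemma hasDerivAt_stableIntegral_re_space (h0 : 0 < γ) (h1 : γ < 1) (hb : 0 < b) (hp : -1 < p)
    (hx : 0 < x) (t : ℝ) :
    HasDerivAt (fun y => (stableIntegral γ b p y t).re)
      (-b * (stableIntegral γ b (p + γ) x t).re) x := by
  have := Complex.reCLM.hasFDerivAt.comp_hasDerivAt x
    (hasDerivAt_stableIntegral_space h0 h1 hb hp hx t)
  refine this.congr_deriv ?_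
  rw [Complex.reCLM_apply, ← Complex.ofReal_neg, Complex.re_ofReal_mul]

/-- Two derivatives given as explicit functions on an open set, the second one continuous, make a
function twice continuously differentiable. -/
lemma contDiffAt_two_of_hasDerivAt {f f₁ f₂ : ℝ → ℝ} {s : Set ℝ} (hs : IsOpen s)
    (hf : ∀ y ∈ s, HasDerivAt f (f₁ y) y) (hf₁ : ∀ y ∈ s, HasDerivAt f₁ (f₂ y) y)
    (hf₂ : ContinuousOn f₂ s) (hx : x ∈ s) :
    ContDiffAt ℝ (2 : ℕ) f x ∧ iteratedDeriv 2 f x = f₂ x := by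
  have d1 : ∀ y ∈ s, deriv f y = f₁ y := fun y hy => (hf y hy).deriv
  have d2 : ∀ y ∈ s, deriv (deriv f) y = f₂ y := fun y hy => by
    rw [← (hf₁ y hy).deriv]
    exact (eventuallyEq_of_mem (hs.mem_nhds hy) d1).deriv_eq
  refine ⟨?_, by rw [iteratedDeriv_succ, iteratedDeriv_one, d2 x hx]⟩
  refine ContDiffOn.contDiffAt ?_ (hs.mem_nhds hx)
  have h1 : ContDiffOn ℝ (0 + 1) (deriv f) s := by
    rw [contDiffOn_succ_iff_deriv_of_isOpen hs]
    refine ⟨fun y hy => ((hf₁ y hy).congr_of_eventuallyEq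
      (eventuallyEq_of_mem (hs.mem_nhds hy) d1)).differentiableAt.differentiableWithinAt,
      by simp, contDiffOn_zero.2 (hf₂.congr d2)⟩
  have h2 : ContDiffOn ℝ (1 + 1) f s := by
    rw [contDiffOn_succ_iff_deriv_of_isOpen hs]
    exact ⟨fun y hy => (hf y hy).differentiableAt.differentiableWithinAt, by simp,
      by simpa using h1⟩
  simpa [one_add_one_eq_two] using h2

/-- Both sides of the equation are multiples of the oscillatory integral with exponent `γ`. -/
theorem inverseStableDensity_equation (hγ : 1 / 2 ≤ γ) (h1 : γ < 1) (hb : 0 < b) (hx : 0 < x)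
    (t : ℝ) : ∃ q : ℝ,
      HasNegRLDerivAt (1 / γ) (fun y => inverseStableDensity γ b y t) q x ∧
      HasDerivAt (fun s => inverseStableDensity γ b x s) (b ^ (-(1 / γ)) * q) t := by
  have h0 : 0 < γ := by linarith
  have hα1 : 1 < 1 / γ := by rw [lt_div_iff₀ h0]; linarith
  have hα2 : 1 / γ ≤ 2 := by rw [div_le_iff₀ h0]; linarith
  have hceil : ⌈1 / γ⌉₊ = 2 := by
    rw [Nat.ceil_eq_iff (by norm_num)]; norm_num
    exact ⟨by simpa using hα1, by simpa using hα2⟩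
  set ν : ℝ := 2 - 1 / γ with hνdef
  have hν : 0 ≤ ν := by linarith
  have hν1 : ν < 1 := by linarith
  -- The fractional integral has exponent `-γ`, so two derivatives in `x` lead to the exponent `γ`.
  have hγν : γ - 1 - γ * ν = -γ := by rw [hνdef]; field_simp; ring
  set C : ℝ := b / (2 * Real.pi) * b ^ (-ν) with hC
  set f := negFracIntegral ν (fun y => inverseStableDensity γ b y t) with hf
  have hfeq : ∀ y ∈ Ioi (0 : ℝ), f y = C * (stableIntegral γ b (-γ) y t).re := fun y hy => by
    rw [hf, negFracIntegral_inverseStableDensity h0 h1 hb hν hν1 hy, hγν]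
  have key := contDiffAt_two_of_hasDerivAt (f := f) (x := x)
    (f₁ := fun y => C * (-b * (stableIntegral γ b (-γ + γ) y t).re))
    (f₂ := fun y => C * (-b * (-b * (stableIntegral γ b (-γ + γ + γ) y t).re)))
    isOpen_Ioi
    (fun y hy => ((hasDerivAt_stableIntegral_re_space h0 h1 hb (by linarith) hy t).const_mul
      C).congr_of_eventuallyEq (eventuallyEq_of_mem (Ioi_mem_nhds hy) hfeq))
    (fun y hy => ((hasDerivAt_stableIntegral_re_space h0 h1 hb (by linarith) hy t).const_mul
      (-b)).const_mul C)
    (fun y hy => ((((hasDerivAt_stableIntegral_re_space (p := -γ + γ + γ) h0 h1 hb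
      (by linarith) hy t).continuousAt.const_mul (-b)).const_mul (-b)).const_mul
        C).continuousWithinAt)
    hx
  refine ⟨C * b ^ 2 * (stableIntegral γ b γ x t).re, ⟨?_, ?_, ?_⟩, ?_⟩
  · rw [hceil]
    intro hlt
    have hν0 : 0 < ν := by push_cast at hlt; linarith
    filter_upwards [Ioi_mem_nhds hx] with z hz
    have := integrableOn_frac_inverseStableDensity h0 h1 hb hν0 hν1 hz t
    simpa [hνdef] using this
  · rw [hceil]
    exact key.1
  · rw [hceil]
    have e := key.2
    rw [neg_add_cancel, zero_add] at e
    rw [show (((2 : ℕ) : ℝ) - 1 / γ) = ν by simp [hνdef], ← hf, e]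
    ring
  · have hd := Complex.reCLM.hasFDerivAt.comp_hasDerivAt t
      (hasDerivAt_stableIntegral_time (p := γ - 1) h0 h1 hb (by linarith) hx t)
    have hfun : (fun s => inverseStableDensity γ b x s) =
        fun s => b / (2 * Real.pi) * (stableIntegral γ b (γ - 1) x s).re :=
      funext fun s => inverseStableDensity_eq h0 h1 hb hx s
    rw [hfun]
    refine (hd.const_mul (b / (2 * Real.pi))).congr_deriv ?_
    rw [Complex.reCLM_apply, sub_add_cancel, hC]
    have hpow : b ^ (-(1 / γ)) * (b ^ (-ν) * b ^ 2) = 1 := by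
      rw [← Real.rpow_natCast b 2, ← Real.rpow_add hb, ← Real.rpow_add hb]
      have : -(1 / γ) + (-ν + ((2 : ℕ) : ℝ)) = 0 := by rw [hνdef]; push_cast; ring
      rw [this, Real.rpow_zero]
    linear_combination -(b / (2 * Real.pi) * (stableIntegral γ b γ x t).re) * hpow

end

/-! ### The law of the subordinator -/

section
open scoped FourierTransform ComplexConjugate

variable {γ b : ℝ}

lemma conj_halfPlanePow (p l : ℝ) : conj (halfPlanePow p l) = halfPlanePow p (-l) := by
  have h := Complex.conj_cpow (-Complex.I * (l : ℂ)) (p : ℂ) (by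
    intro h; rw [Complex.arg_eq_pi_iff] at h; simp at h)
  rw [Complex.conj_ofReal] at h
  rw [halfPlanePow, halfPlanePow, ← h]
  simp

lemma conj_stableIntegral (γ b p x t : ℝ) :
    conj (stableIntegral γ b p x t) = stableIntegral γ b p x t := by
  rw [stableIntegral, ← integral_conj, ← integral_neg_eq_self]
  congr with l
  simp only [stableKernel, map_mul, ← Complex.exp_conj, conj_halfPlanePow]
  simp

lemma ofReal_stableDensity (h0 : 0 < γ) (b u : ℝ) :
    (stableDensity γ γ b u : ℂ) = 1 / (2 * Real.pi) * stableIntegral γ b 0 1 u := by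
  rw [stableDensity_eq h0, Complex.ofReal_mul,
    Complex.conj_eq_iff_re.1 (conj_stableIntegral _ _ _ _ _)]
  push_cast; rfl

/-- Fourier inversion recovers the characteristic function from the density. -/
lemma charFun_stableDensity (h0 : 0 < γ) (h1 : γ < 1) (hb : 0 < b) {X : Type*}
    [MeasurableSpace X] {P : Measure X} [IsProbabilityMeasure P] {Y : X → ℝ}
    (hY : HasDensity Y P (stableDensity γ γ b)) (l : ℝ) :
    charFun (P.map Y) l = Complex.exp (-(b * halfPlanePow γ l)) := by
  set g := stableDensity γ γ b with hg
  set μ : Measure ℝ := volume.withDensity fun x => ENNReal.ofReal (g x) with hμ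
  have hmap : P.map Y = μ := hY.hasLaw.map_eq
  have : IsProbabilityMeasure μ := hmap ▸ Measure.isProbabilityMeasure_map hY.hasLaw.aemeasurable
  have hgint : Integrable g := by
    refine ⟨hY.measurable.aestronglyMeasurable, ?_⟩
    rw [hasFiniteIntegral_iff_ofReal (ae_of_all _ hY.nonneg), ← setLIntegral_univ,
      ← withDensity_apply _ MeasurableSet.univ]
    exact measure_lt_top μ univ
  have hpi : (0 : ℝ) < 2 * Real.pi := by positivity
  -- Mathlib's transform has the frequency `2π v`, hence the rescaled integrand.
  set f : ℝ → ℂ := fun v => stableKernel γ b 0 1 0 (2 * Real.pi * v) with hf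
  have hfe : ∀ v, f v = Complex.exp (-(b * halfPlanePow γ (2 * Real.pi * v))) := fun v => by
    simp [hf, stableKernel]
  have hfc : Continuous f := by
    have := continuous_halfPlanePow h0
    rw [funext hfe]
    fun_prop
  have hfi : Integrable f :=
    (integrable_stableKernel h0 h1 hb (by norm_num) one_pos 0).comp_mul_left' hpi.ne'
  have hFf : 𝓕 f = fun w => (g w : ℂ) := by
    ext w
    rw [Real.fourier_real_eq_integral_exp_smul, hg, ofReal_stableDensity h0, stableIntegral]
    have := Measure.integral_comp_mul_left (fun l => stableKernel γ b 0 1 w l) (2 * Real.pi)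
    rw [abs_of_pos (inv_pos.2 hpi), Complex.real_smul] at this
    rw [one_div, show ((2 * Real.pi : ℂ))⁻¹ = (((2 * Real.pi)⁻¹ : ℝ) : ℂ) by push_cast; rfl, ← this]
    refine integral_congr_ae (ae_of_all _ fun v => ?_)
    simp only [hf, stableKernel, smul_eq_mul, Complex.ofReal_zero, mul_zero, Complex.exp_zero,
      one_mul]
    congr 2
    push_cast; ring
  have hinv := hfc.fourierInv_fourier_eq hfi (by rw [hFf]; exact hgint.ofReal)
  have h2 := congrFun hinv (l / (2 * Real.pi))
  rw [hFf, Real.fourierInv_eq', hfe, mul_div_cancel₀ _ hpi.ne'] at h2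
  rw [← h2, hmap, charFun_apply_real, hμ, integral_withDensity_eq_integral_toReal_smul
    hY.measurable.ennreal_ofReal (ae_of_all _ fun _ => ENNReal.ofReal_lt_top)]
  refine integral_congr_ae (ae_of_all _ fun v => ?_)
  simp only [ENNReal.toReal_ofReal (hY.nonneg v), Complex.real_smul, smul_eq_mul]
  rw [mul_comm]
  congr 2
  simp only [RCLike.inner_apply, conj_trivial]
  push_cast
  have : (Real.pi : ℂ) ≠ 0 := by exact_mod_cast Real.pi_ne_zero
  field_simp

end

section
variable {Ω : Type*} [MeasurableSpace Ω] {P : Measure Ω} [IsProbabilityMeasure P] {γ b : ℝ}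
  {D : ℝ≥0 → Ω → ℝ}

lemma charFun_increments_add (hD : IsStableSubordinator γ b D P) (s x : ℝ≥0) (l : ℝ) :
    charFun (P.map (D (s + x))) l = charFun (P.map (D s)) l * charFun (P.map (D x)) l := by
  have hind := hD.indep.indepFun_eval_sub zero_le (le_self_add : s ≤ s + x) hD.start
  have h := hind.charFun_map_add_eq_mul (hD.measurable s).aemeasurable
    ((hD.measurable (s + x)).sub (hD.measurable s)).aemeasurable
  rw [add_sub_cancel] at h
  rw [h, Pi.mul_apply]
  congr 2
  exact (hD.stationary s x).map_eq

lemma charFun_zero_time (hD : IsStableSubordinator γ b D P) (l : ℝ) :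
    charFun (P.map (D 0)) l = 1 := by
  rw [charFun_apply_real, integral_map (hD.measurable 0).aemeasurable (by fun_prop)]
  rw [integral_congr_ae (g := fun _ => (1 : ℂ))]
  · simp
  · filter_upwards [hD.start] with ω hω
    simp [hω]

lemma charFun_nsmul (hD : IsStableSubordinator γ b D P) (n : ℕ) (x : ℝ≥0) (l : ℝ) :
    charFun (P.map (D (n * x))) l = charFun (P.map (D x)) l ^ n := by
  induction n with
  | zero => simp [charFun_zero_time hD]
  | succ n ih => rw [Nat.cast_succ, add_mul, one_mul, charFun_increments_add hD, ih, pow_succ]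

/-- A continuous function on the line whose `n`-th power is `1` and which is `1` somewhere is
constant, as the `n`-th roots of unity are discrete. -/
lemma eq_one_of_pow_eq_one {f : ℝ → ℂ} (hf : Continuous f) {n : ℕ} (hn : n ≠ 0)
    (h : ∀ l, f l ^ n = 1) {l₀ : ℝ} (h0 : f l₀ = 1) (l : ℝ) : f l = 1 := by
  have hfin : {z : ℂ | z ^ n = 1}.Finite := by
    refine (Polynomial.nthRoots n (1 : ℂ)).toFinset.finite_toSet.subset fun z hz => ?_
    simpa [Polynomial.mem_nthRoots (Nat.pos_of_ne_zero hn)] using hz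
  rw [← h0]
  exact isPreconnected_univ.constant_of_mapsTo hfin.isDiscrete hf.continuousOn
    (fun l _ => h l) (mem_univ l) (mem_univ l₀)

/-- At rational times the characteristic function is determined up to roots of unity by its value
at time `1`; continuity in the frequency removes the ambiguity. -/
lemma charFun_rational_time (h0 : 0 < γ) (h1 : γ < 1) (hb : 0 < b)
    (hD : IsStableSubordinator γ b D P) (m n : ℕ) (l : ℝ) :
    charFun (P.map (D (m / (n + 1)))) l =
      Complex.exp (-((m / (n + 1) : ℝ≥0) : ℝ) * (b * halfPlanePow γ l)) := by
  set y : ℝ≥0 := 1 / (n + 1) with hy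
  have hny : ((n + 1 : ℕ) : ℝ≥0) * y = 1 := by rw [hy]; push_cast; field_simp
  have hnyC : ((n + 1 : ℕ) : ℂ) * (y : ℝ) = 1 := by
    exact_mod_cast congrArg (fun z : ℝ≥0 => ((z : ℝ) : ℂ)) hny
  have hP : IsProbabilityMeasure (P.map (D y)) :=
    Measure.isProbabilityMeasure_map (hD.measurable y).aemeasurable
  have hroot : charFun (P.map (D y)) l * Complex.exp ((y : ℝ) * (b * halfPlanePow γ l)) = 1 := by
    refine eq_one_of_pow_eq_one (n := n + 1) (l₀ := 0) (f := fun l => charFun (P.map (D y)) l *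
      Complex.exp ((y : ℝ) * (b * halfPlanePow γ l))) ?_ (by simp) (fun l => ?_) ?_ l
    · have := continuous_halfPlanePow h0
      have h2 : Continuous (charFun (P.map (D y))) := continuous_charFun
      fun_prop
    · rw [mul_pow, ← charFun_nsmul hD, hny, charFun_stableDensity h0 h1 hb hD.density_one,
        ← Complex.exp_nat_mul, ← Complex.exp_add, ← mul_assoc, hnyC]
      simp
    · simp [halfPlanePow_zero h0.ne']
  have hval : charFun (P.map (D y)) l = Complex.exp (-((y : ℝ) * (b * halfPlanePow γ l))) := by
    rw [Complex.exp_neg]; exact eq_inv_of_mul_eq_one_left hroot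
  have e : ((m : ℝ≥0) / (n + 1)) = m * y := by rw [hy]; ring
  rw [e, charFun_nsmul hD, hval, ← Complex.exp_nat_mul]
  congr 1; push_cast; ring

/-- Right-continuity of the paths extends the formula from rational times to all times. -/
lemma charFun_stableSubordinator (h0 : 0 < γ) (h1 : γ < 1) (hb : 0 < b)
    (hD : IsStableSubordinator γ b D P) (x : ℝ≥0) (l : ℝ) :
    charFun (P.map (D x)) l = Complex.exp (-(x : ℝ) * (b * halfPlanePow γ l)) := by
  -- Rational times `q n` that decrease to `x` from the right.
  set q : ℕ → ℝ≥0 := fun n => ((⌊x * (n + 1)⌋₊ + 1 : ℕ) : ℝ≥0) / (n + 1) with hq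
  have hxq : ∀ n, x ≤ q n := fun n => by
    simp only [hq]
    rw [le_div_iff₀ (by positivity)]
    push_cast
    exact (Nat.lt_floor_add_one _).le
  have hqx : ∀ n, q n ≤ x + 1 / ((n : ℝ≥0) + 1) := fun n => by
    simp only [hq]
    rw [div_le_iff₀ (by positivity), add_mul, one_div_mul_cancel (by positivity)]
    push_cast
    gcongr
    exact Nat.floor_le zero_le
  have hlim : Tendsto q atTop (𝓝 x) := by
    refine tendsto_of_tendsto_of_tendsto_of_le_of_le tendsto_const_nhds ?_ hxq hqx
    simpa using (tendsto_one_div_add_atTop_nhds_zero_nat (𝕜 := ℝ≥0)).const_add x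
  have hlim' : Tendsto q atTop (𝓝[≥] x) :=
    tendsto_nhdsWithin_iff.2 ⟨hlim, Eventually.of_forall hxq⟩
  have e : ∀ y, charFun (P.map (D y)) l =
      ∫ ω, Complex.exp (l * D y ω * Complex.I) ∂P := fun y => by
    rw [charFun_apply_real, integral_map (hD.measurable y).aemeasurable (by fun_prop)]
  have t1 : Tendsto (fun n => charFun (P.map (D (q n))) l) atTop
      (𝓝 (charFun (P.map (D x)) l)) := by
    simp only [e]
    refine tendsto_integral_filter_of_dominated_convergence (fun _ => 1) ?_ ?_
      (integrable_const _) ?_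
    · refine Eventually.of_forall fun n => ?_
      have := hD.measurable (q n)
      exact Measurable.aestronglyMeasurable (by fun_prop)
    · refine Eventually.of_forall fun n => ae_of_all _ fun ω => ?_
      rw [← Complex.ofReal_mul, Complex.norm_exp_ofReal_mul_I]
    · filter_upwards [hD.paths] with ω hω
      have h3 : Tendsto (fun n => D (q n) ω) atTop (𝓝 (D x ω)) := (hω.2 x).tendsto.comp hlim'
      have h4 : Continuous fun z : ℝ => Complex.exp (l * z * Complex.I) := by fun_prop
      exact (h4.tendsto _).comp h3
  have t2 : Tendsto (fun n => charFun (P.map (D (q n))) l) atTop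
      (𝓝 (Complex.exp (-(x : ℝ) * (b * halfPlanePow γ l)))) := by
    have h4 : Continuous fun z : ℝ≥0 => Complex.exp (-(z : ℝ) * (b * halfPlanePow γ l)) := by
      fun_prop
    refine ((h4.tendsto x).comp hlim).congr fun n => ?_
    exact (charFun_rational_time h0 h1 hb hD _ n l).symm
  exact tendsto_nhds_unique t1 t2

/-- Self-similarity: `D x` is distributed as `x^(1/γ) D 1`. -/
lemma map_stableSubordinator (h0 : 0 < γ) (h1 : γ < 1) (hb : 0 < b)
    (hD : IsStableSubordinator γ b D P) {x : ℝ≥0} (hx : 0 < x) :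
    P.map (D x) = P.map (fun ω => (x : ℝ) ^ (1 / γ) * D 1 ω) := by
  have i1 := Measure.isProbabilityMeasure_map (μ := P) (hD.measurable x).aemeasurable
  have i2 := Measure.isProbabilityMeasure_map (μ := P)
    ((hD.measurable 1).const_mul ((x : ℝ) ^ (1 / γ))).aemeasurable
  refine Measure.ext_of_charFun (funext fun l => ?_)
  rw [charFun_map_mul_comp (hD.measurable 1).aemeasurable,
    charFun_stableSubordinator h0 h1 hb hD, charFun_stableSubordinator h0 h1 hb hD,
    halfPlanePow_scale h0 (by exact_mod_cast hx)]
  congr 1; push_cast; ring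

end

/-! ### The law of the hitting time -/

lemma le_measure_Iic_of_forall_gt {ν : Measure ℝ} {x : ℝ} {c : ENNReal}
    (hfin : ν (Iic (x + 1)) ≠ ⊤) (h : ∀ y, x < y → c ≤ ν (Iic y)) : c ≤ ν (Iic x) := by
  have hanti : Antitone fun n : ℕ => Iic (x + 1 / ((n : ℝ) + 1)) := fun m n hmn =>
    Iic_subset_Iic.2 (by gcongr)
  have hinter : ⋂ n : ℕ, Iic (x + 1 / ((n : ℝ) + 1)) = Iic x := by
    ext z
    simp only [mem_iInter, mem_Iic]
    refine ⟨fun hz => ?_, fun hz n => hz.trans (by simp; positivity)⟩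
    have ht : Tendsto (fun n : ℕ => x + 1 / ((n : ℝ) + 1)) atTop (𝓝 x) := by
      simpa using (tendsto_one_div_add_atTop_nhds_zero_nat (𝕜 := ℝ)).const_add x
    exact ge_of_tendsto' ht hz
  have ht := tendsto_measure_iInter_atTop (μ := ν)
    (fun n : ℕ => (measurableSet_Iic (a := x + 1 / ((n : ℝ) + 1))).nullMeasurableSet) hanti
    ⟨0, by simpa using hfin⟩
  rw [hinter] at ht
  exact ge_of_tendsto' ht fun n => h _ (by simp; positivity)

section
variable {Ω : Type*} {t : ℝ} {D : ℝ≥0 → Ω → ℝ}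

lemma hittingTime_le {ω : Ω} {y : ℝ≥0} (hy : 0 < y) (h : t < D y ω) :
    hittingTime D t ω ≤ y :=
  NNReal.coe_le_coe.2 (csInf_le' ⟨hy, h⟩)

/-- The set of times is assumed nonempty because the infimum of the empty set is `0`. -/
lemma exists_lt_of_hittingTime_lt {ω : Ω} (hne : ∃ x : ℝ≥0, 0 < x ∧ t < D x ω) {y : ℝ}
    (h : hittingTime D t ω < y) : ∃ z : ℝ≥0, 0 < z ∧ (z : ℝ) < y ∧ t < D z ω := by
  have hy : 0 ≤ y := (NNReal.coe_nonneg _).trans h.le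
  lift y to ℝ≥0 using hy
  obtain ⟨z, hz, hzy⟩ := exists_lt_of_csInf_lt hne (NNReal.coe_lt_coe.1 h)
  exact ⟨z, hz.1, NNReal.coe_lt_coe.2 hzy, hz.2⟩

end

lemma inverseStableDensity_of_nonpos {γ b x t : ℝ} (hx : x ≤ 0) :
    inverseStableDensity γ b x t = 0 :=
  if_neg (not_lt.2 hx)

section
variable {Ω : Type*} [MeasurableSpace Ω] {P : Measure Ω} {γ b t : ℝ}
  {D : ℝ≥0 → Ω → ℝ}

lemma inverseStableDensity_nonneg (h0 : 0 < γ) (hD : IsStableSubordinator γ b D P) (ht : 0 < t)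
    (x : ℝ) : 0 ≤ inverseStableDensity γ b x t := by
  unfold inverseStableDensity
  split_ifs with hx
  · have := hD.density_one.nonneg (t * x ^ (-(1 / γ)))
    positivity
  · exact le_rfl

lemma measurable_inverseStableDensity (hD : IsStableSubordinator γ b D P) (t : ℝ) :
    Measurable fun x => inverseStableDensity γ b x t := by
  have := hD.density_one.measurable
  unfold inverseStableDensity
  refine Measurable.ite measurableSet_Ioi ?_ measurable_const
  fun_prop

/-- The change of variables `u = t x^(-1/γ)`. -/
lemma withDensity_inverseStableDensity_Iic (h0 : 0 < γ) (hD : IsStableSubordinator γ b D P)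
    (ht : 0 < t) {x : ℝ} (hx : 0 < x) :
    volume.withDensity (fun x => ENNReal.ofReal (inverseStableDensity γ b x t)) (Iic x) =
      P {ω | t * x ^ (-(1 / γ)) < D 1 ω} := by
  set φ : ℝ → ℝ := fun y => t * y ^ (-(1 / γ)) with hφ
  have hneg : -(1 / γ) < 0 := by simpa using h0
  have hanti : ∀ y z : ℝ, 0 < y → y < z → φ z < φ y := fun y z hy hyz => by
    simp only [hφ]
    exact mul_lt_mul_of_pos_left (Real.rpow_lt_rpow_of_neg hy hyz hneg) ht
  have himage : φ '' Ioo 0 x = Ioi (φ x) := by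
    ext u
    constructor
    · rintro ⟨y, hy, rfl⟩
      exact hanti y x hy.1 hy.2
    · intro hu
      have hu0 : 0 < u := lt_trans (by simp only [hφ]; positivity) (mem_Ioi.1 hu)
      have hy : φ ((u / t) ^ (-γ)) = u := by
        simp only [hφ]
        rw [← Real.rpow_mul (by positivity), show -γ * -(1 / γ) = 1 by field_simp, Real.rpow_one]
        field_simp
      refine ⟨(u / t) ^ (-γ), ⟨by positivity, ?_⟩, hy⟩
      by_contra hle
      rcases (not_lt.1 hle).eq_or_lt with h | h
      · rw [← h] at hy; exact absurd hy (ne_of_lt hu)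
      · have := hanti x _ hx h
        rw [hy] at this
        exact lt_asymm this hu
  have hinj : InjOn φ (Ioo 0 x) := fun y hy z hz hyz => by
    by_contra hne
    rcases lt_or_gt_of_ne hne with h | h
    · exact (hanti y z hy.1 h).ne' hyz
    · exact (hanti z y hz.1 h).ne hyz
  have hder : ∀ y ∈ Ioo 0 x, HasDerivWithinAt φ (t * (-(1 / γ) * y ^ (-(1 / γ) - 1))) (Ioo 0 x) y :=
    fun y hy => ((Real.hasDerivAt_rpow_const (Or.inl hy.1.ne')).const_mul t).hasDerivWithinAt
  have hcv := lintegral_image_eq_lintegral_abs_deriv_mul measurableSet_Ioo hder hinj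
    (fun u => ENNReal.ofReal (stableDensity γ γ b u))
  have hlaw : P {ω | φ x < D 1 ω} =
      ∫⁻ u in Ioi (φ x), ENNReal.ofReal (stableDensity γ γ b u) := by
    rw [← withDensity_apply _ measurableSet_Ioi]
    exact hD.density_one.hasLaw.measure_eq measurableSet_Ioi
  rw [hlaw, ← himage, hcv, withDensity_apply _ measurableSet_Iic]
  have hsplit : ∫⁻ y in Iic x, ENNReal.ofReal (inverseStableDensity γ b y t) =
      ∫⁻ y in Ioo 0 x, ENNReal.ofReal (inverseStableDensity γ b y t) := by
    rw [← Iic_union_Ioc_eq_Iic hx.le, lintegral_union measurableSet_Ioc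
      (Iic_disjoint_Ioc le_rfl),
      setLIntegral_congr_fun (g := fun _ => 0) measurableSet_Iic
        (fun y hy => by rw [inverseStableDensity_of_nonpos hy, ENNReal.ofReal_zero]),
      lintegral_zero, zero_add]
    exact setLIntegral_congr Ioo_ae_eq_Ioc.symm
  rw [hsplit]
  refine setLIntegral_congr_fun measurableSet_Ioo fun y hy => ?_
  have hy0 : 0 < y := hy.1
  simp only [inverseStableDensity, if_pos hy0]
  rw [← ENNReal.ofReal_mul (abs_nonneg _)]
  congr 2
  rw [abs_mul, abs_mul, abs_neg, abs_of_pos ht, abs_of_pos (by positivity),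
    abs_of_pos (by positivity), show -(1 / γ) - 1 = -1 - 1 / γ by ring]
  ring

variable [IsProbabilityMeasure P]

lemma measure_lt_stableSubordinator (h0 : 0 < γ) (h1 : γ < 1) (hb : 0 < b)
    (hD : IsStableSubordinator γ b D P) (t : ℝ) {x : ℝ≥0} (hx : 0 < x) :
    P {ω | t < D x ω} = P {ω | t * (x : ℝ) ^ (-(1 / γ)) < D 1 ω} := by
  have hx' : (0 : ℝ) < x := hx
  have e1 : P {ω | t < D x ω} = P.map (D x) (Ioi t) :=
    (Measure.map_apply (hD.measurable x) measurableSet_Ioi).symm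
  rw [e1, map_stableSubordinator h0 h1 hb hD hx,
    Measure.map_apply ((hD.measurable 1).const_mul _) measurableSet_Ioi]
  congr 1
  ext ω
  rw [mem_preimage, mem_Ioi, mem_ofPred_eq, Real.rpow_neg hx'.le, ← div_eq_mul_inv,
    div_lt_iff₀ (by positivity), mul_comm]

/-- Almost surely the process exceeds every level, since
`P (D n ≤ t) = P (D 1 ≤ t n^(-1/γ))` tends to `P (D 1 ≤ 0) = 0`. -/
lemma ae_exists_lt_stableSubordinator (h0 : 0 < γ) (h1 : γ < 1) (hb : 0 < b)
    (hD : IsStableSubordinator γ b D P) (t : ℝ) : ∀ᵐ ω ∂P, ∃ x : ℝ≥0, 0 < x ∧ t < D x ω := by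
  have hprob : IsProbabilityMeasure (P.map (D 1)) :=
    Measure.isProbabilityMeasure_map (hD.measurable 1).aemeasurable
  have hzero : P.map (D 1) (Iic 0) = 0 := by
    have hac : P.map (D 1) ≪ volume := by
      rw [hD.density_one.hasLaw.map_eq]; exact withDensity_absolutelyContinuous _ _
    rw [← measure_congr (hac.ae_eq Iio_ae_eq_Iic),
      Measure.map_apply (hD.measurable 1) measurableSet_Iio]
    have : ∀ᵐ ω ∂P, 0 ≤ D 1 ω := by
      filter_upwards [hD.start, hD.paths] with ω hω hω'
      rw [← hω]; exact hω'.1 zero_le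
    rw [ae_iff] at this
    simpa [preimage, Iio] using this
  rw [ae_iff, ← nonpos_iff_eq_zero, ← hzero]
  refine le_measure_Iic_of_forall_gt (measure_ne_top _ _) fun ε hε => ?_
  have hlim : Tendsto (fun y : ℝ => t * y ^ (-(1 / γ))) atTop (𝓝 0) := by
    simpa using (tendsto_rpow_neg_atTop (show 0 < 1 / γ by positivity)).const_mul t
  obtain ⟨y, hy, hy0⟩ := ((hlim.eventually (gt_mem_nhds hε)).and (eventually_gt_atTop 0)).exists
  set z : ℝ≥0 := ⟨y, hy0.le⟩
  have hz : 0 < z := hy0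
  rw [Measure.map_apply (hD.measurable 1) measurableSet_Iic]
  calc P {ω | ¬∃ x : ℝ≥0, 0 < x ∧ t < D x ω}
      ≤ P {ω | t < D z ω}ᶜ := measure_mono fun ω hω h => hω ⟨z, hz, h⟩
    _ = P {ω | t * (z : ℝ) ^ (-(1 / γ)) < D 1 ω}ᶜ := by
        rw [prob_compl_eq_one_sub (measurableSet_lt measurable_const (hD.measurable z)),
          prob_compl_eq_one_sub (measurableSet_lt measurable_const (hD.measurable 1)),
          measure_lt_stableSubordinator h0 h1 hb hD t hz]
    _ ≤ _ := measure_mono fun ω hω => by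
        have h : ¬ t * (z : ℝ) ^ (-(1 / γ)) < D 1 ω := hω
        exact (not_lt.1 h).trans (le_of_lt hy)

/-- The infimum runs over uncountably many times. By monotonicity of the paths rational times
suffice, outside a null set. -/
lemma aemeasurable_hittingTime (h0 : 0 < γ) (h1 : γ < 1) (hb : 0 < b)
    (hD : IsStableSubordinator γ b D P) (t : ℝ) : AEMeasurable (hittingTime D t) P := by
  have key : ∀ y : ℝ, NullMeasurableSet (hittingTime D t ⁻¹' Iio y) P := by
    intro y
    have hm : MeasurableSet (⋃ q : ℚ≥0, {ω | 0 < q ∧ (q : ℝ) < y ∧ t < D (q : ℝ≥0) ω}) := by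
      refine MeasurableSet.iUnion fun q => ?_
      have := hD.measurable (q : ℝ≥0)
      measurability
    refine hm.nullMeasurableSet.congr ?_
    filter_upwards [hD.paths, ae_exists_lt_stableSubordinator h0 h1 hb hD t] with ω hω hne
    refine propext ⟨fun h => ?_, fun h => ?_⟩
    · obtain ⟨q, hq, hqy, hq2⟩ := mem_iUnion.1 h
      have := hittingTime_le (D := D) (t := t) (ω := ω) (y := (q : ℝ≥0)) (by exact_mod_cast hq) hq2
      exact this.trans_lt (by exact_mod_cast hqy)
    · obtain ⟨z, hz, hzy, hz2⟩ := exists_lt_of_hittingTime_lt hne h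
      obtain ⟨q, hq1, hq2⟩ := exists_rat_btwn hzy
      have hq0 : (0 : ℝ) < q := (NNReal.coe_nonneg z).trans_lt hq1
      have hq0' : (0 : ℚ) ≤ q := by exact_mod_cast hq0.le
      lift q to ℚ≥0 using hq0'
      refine mem_iUnion.2 ⟨q, by exact_mod_cast hq0, by simpa using hq2, hz2.trans_le (hω.1 ?_)⟩
      rw [← NNReal.coe_le_coe]
      exact_mod_cast hq1.le
  have h : @Measurable (NullMeasurableSpace Ω P) ℝ _ _ (hittingTime D t) :=
    measurable_of_Iio key
  exact NullMeasurable.aemeasurable fun s hs => h hs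

/-- The hitting time is squeezed between events of the process,
`P (E < x) ≤ P (D x > t) ≤ P (E ≤ x)`, and `P (D x > t)` is continuous in `x`. -/
theorem hasDensity_hittingTime (h0 : 0 < γ) (h1 : γ < 1) (hb : 0 < b)
    (hD : IsStableSubordinator γ b D P) (ht : 0 < t) :
    HasDensity (hittingTime D t) P fun x => inverseStableDensity γ b x t := by
  have hE := aemeasurable_hittingTime h0 h1 hb hD t
  refine ⟨inverseStableDensity_nonneg h0 hD ht, measurable_inverseStableDensity hD t, hE, ?_⟩
  set ν : Measure ℝ :=
    volume.withDensity fun x => ENNReal.ofReal (inverseStableDensity γ b x t) with hν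
  have hprob := Measure.isProbabilityMeasure_map hE
  have hνpos : ∀ y : ℝ≥0, 0 < y → ν (Iic y) = P {ω | t < D y ω} := fun y hy => by
    rw [measure_lt_stableSubordinator h0 h1 hb hD t hy]
    exact withDensity_inverseStableDensity_Iic h0 hD ht hy
  have hνneg : ∀ x ≤ (0 : ℝ), ν (Iic x) = 0 := fun x hx => by
    rw [hν, withDensity_apply _ measurableSet_Iic,
      setLIntegral_congr_fun (g := fun _ => 0) measurableSet_Iic
        (fun y hy => by
          rw [inverseStableDensity_of_nonpos (le_trans hy hx), ENNReal.ofReal_zero]), lintegral_zero]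
  refine Measure.ext_of_Iic _ _ fun x => le_antisymm ?_ ?_
  · rw [Measure.map_apply_of_aemeasurable hE measurableSet_Iic]
    rcases lt_or_ge x 0 with hx | hx
    · have : hittingTime D t ⁻¹' Iic x = ∅ := by
        ext ω
        simpa [hittingTime] using hx.trans_le (NNReal.coe_nonneg _)
      simp [this]
    · refine le_measure_Iic_of_forall_gt ?_ fun y hy => ?_
      · have h := hνpos ⟨x + 1, by linarith⟩ (show (0 : ℝ) < x + 1 by linarith)
        exact h.trans_ne (measure_ne_top _ _)
      · have hy0 : 0 < y := hx.trans_lt hy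
        lift y to ℝ≥0 using hy0.le
        rw [hνpos y (by exact_mod_cast hy0)]
        refine measure_mono_ae ?_
        filter_upwards [hD.paths, ae_exists_lt_stableSubordinator h0 h1 hb hD t] with ω hω hne hle
        obtain ⟨z, -, hzy, hz⟩ := exists_lt_of_hittingTime_lt hne (lt_of_le_of_lt hle hy)
        exact hz.trans_le (hω.1 (NNReal.coe_le_coe.1 hzy.le))
  · rcases le_or_gt x 0 with hx | hx
    · rw [hνneg x hx]; exact zero_le
    · lift x to ℝ≥0 using hx.le
      have hx' : 0 < x := by exact_mod_cast hx
      rw [hνpos x hx', Measure.map_apply_of_aemeasurable hE measurableSet_Iic]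
      exact measure_mono fun ω hω => hittingTime_le hx' hω

end

lemma continuousOn_inverseStableDensity {γ b : ℝ} (h0 : 0 < γ) (h1 : γ < 1) (hb : 0 < b) (t : ℝ) :
    ContinuousOn (fun x => inverseStableDensity γ b x t) (Ioi 0) := by
  intro x hx
  have h := ((hasDerivAt_stableIntegral_re_space (p := γ - 1) h0 h1 hb (by linarith) hx
    t).continuousAt.const_mul (b / (2 * Real.pi))).continuousWithinAt (s := Ioi 0)
  exact h.congr (fun y hy => inverseStableDensity_eq h0 h1 hb hy t)
    (inverseStableDensity_eq h0 h1 hb hx t)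

theorem corollary4p5 {Ω : Type*} [MeasurableSpace Ω] (P : Measure Ω) [IsProbabilityMeasure P]
    (γ b : ℝ) (hγ : 1 / 2 ≤ γ) (hγ1 : γ < 1) (hb : 0 < b)
    (D : ℝ≥0 → Ω → ℝ) (hD : IsStableSubordinator γ b D P) :
    (∀ t : ℝ, 0 < t →
      HasDensity (hittingTime D t) P (fun x => inverseStableDensity γ b x t) ∧
      ContinuousOn (fun x => inverseStableDensity γ b x t) (Ioi 0)) ∧
    (∀ x t : ℝ, 0 < x → 0 < t →
      ∃ q : ℝ,
        HasNegRLDerivAt (1 / γ) (fun y => inverseStableDensity γ b y t) q x ∧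
        HasDerivAt (fun s => inverseStableDensity γ b x s) (b ^ (-(1 / γ)) * q) t) := by
  have h0 : 0 < γ := by linarith
  exact ⟨fun t ht => ⟨hasDensity_hittingTime h0 hγ1 hb hD ht,
    continuousOn_inverseStableDensity h0 hγ1 hb t⟩,
    fun x t hx _ => inverseStableDensity_equation hγ hγ1 hb hx t⟩
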